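/- Let $\mathbb D$ be the open unit disk. For $s\ge 0$ and $0\le t<1$ let $\mathfrak A_s^t$ be the set of all holomorphic functions $f$ on $\mathbb D$ with $f(0)=0$, $f'(0)=1$ and $$\operatorname{Re}\left[(s-1)\frac{f(z)}{z}+f'(z)\right]\ge st,\qquad z\in\mathbb D\setminus\{0\},$$ and for $s>0$ let $$\xi_0(s)=\int_0^1\frac{1-x}{1+x}\,s\,x^{s-1}\,dx .$$ Let $s_*\ge 0$ and let $T:[s_*,\infty)\to[0,1)$ be differentiable on $(s_*,\infty)$. Call a family of sets indexed by real numbers $s$ a filtration if it is increasing in $s$ with respect to inclusion. Then the family $\{\mathfrak A_s^{T(s)}\}_{s>s_*}$ is a filtration, that is, $\mathfrak A_{s_1}^{T(s_1)}\subseteq\mathfrak A_{s_2}^{T(s_2)}$ whenever $s_*<s_1<s_2$, if and only if $$T'(s)\le (1-T(s))\,\frac{\xi_0(s)}{s}\qquad\text{for all } s>s_* .$$ If, in addition, $T$ is continuous at $s_*$ from the right, then the same condition is also necessary and sufficient for the family $\{\mathfrak A_s^{T(s)}\}_{s\ge s_*}$, which includes the index $s_*$, to be a filtration. -/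

import Mathlib

open Set MeasureTheory

noncomputable section

/-- Holomorphic functions in the open unit disk normalized by `f 0 = 0` and `f' 0 = 1`.
A function on the disk is represented by a function on `ℂ` whose values outside the disk are
irrelevant: no condition below depends on them. -/
def normalizedHolomorphic : Set (ℂ → ℂ) :=
  {f | DifferentiableOn ℂ f (Metric.ball 0 1) ∧ f 0 = 0 ∧ deriv f 0 = 1}

/-- The class `𝔄_s^t`: all normalized holomorphic `f` with
`Re ((s - 1) f(z) / z + f'(z)) ≥ s t` for all `z ≠ 0` in the open unit disk. -/
def classA (s t : ℝ) : Set (ℂ → ℂ) :=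
  {f | f ∈ normalizedHolomorphic ∧
    ∀ z : ℂ, z ∈ Metric.ball (0 : ℂ) 1 → z ≠ 0 →
      s * t ≤ (((s : ℂ) - 1) * (f z / z) + deriv f z).re}

/-- `ξ₀(s) = ∫₀¹ (1 - x) / (1 + x) · s x ^ (s - 1) dx`, for `s > 0`. -/
def xi0 (s : ℝ) : ℝ :=
  ∫ x in (0 : ℝ)..1, (1 - x) / (1 + x) * (s * x ^ (s - 1))

/-- A family of sets with index set `I` is a filtration if it is increasing for inclusion. -/
def IsFiltrationOn {α : Type*} (I : Set ℝ) (F : ℝ → Set α) : Prop :=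
  ∀ s ∈ I, ∀ t ∈ I, s < t → F s ⊆ F t

end

/-! Write `f = z g`; membership in `classA s t` becomes `s Re g + Re (z g') ≥ s t`. For `s > 0`,
Harnack applied to `g + z g' / s`, integrated along radii against `s x ^ (s - 1)`, gives `Re g ≥ t +
(1 - t) ξ₀(s)`, and `extremalFun` shows this is sharp. Since `b g + z g' = (b - a) g + (a g + z
g')`, this yields the exact inclusion criterion `classA_subset_classA_iff`. Necessity of the
differential inequality is the infinitesimal form of that criterion as `b ↓ a`. For sufficiency,
inclusion is transitive, so the criterion forces an inequality between `ξ₀(a)` and `ξ₀(b)`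
(`xi0_mul_le`). It makes `(1 - T s) / (1 - (1 - a / s) ξ₀(a))` monotone in `s`, which recovers the
criterion for every pair (`le_of_deriv_le`). -/

/-! ### Harnack's inequality -/

/-- **Harnack's inequality** for holomorphic functions with nonnegative real part. -/
theorem harnack_lower_bound {P : ℂ → ℂ} (hP : DifferentiableOn ℂ P (Metric.ball 0 1))
    (h0 : P 0 = 1) (hre : ∀ z ∈ Metric.ball (0 : ℂ) 1, 0 ≤ (P z).re) {z : ℂ}
    (hz : z ∈ Metric.ball (0 : ℂ) 1) : (1 - ‖z‖) / (1 + ‖z‖) ≤ (P z).re := by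
  have hne : ∀ w ∈ Metric.ball (0 : ℂ) 1, P w + 1 ≠ 0 := fun w hw h => by
    have := congrArg Complex.re h
    simp at this
    linarith [hre w hw]
  have hz1 : ‖z‖ < 1 := by simpa using hz
  -- The Cayley transform sends the right half-plane into the unit disk and `1` to `0`, so the
  -- Schwarz lemma applies.
  have hQ : ‖(P z - 1) / (P z + 1)‖ ≤ ‖z‖ := by
    refine Complex.norm_le_norm_of_mapsTo_ball (f := fun w => (P w - 1) / (P w + 1)) (R := 1)
      ((hP.sub_const 1).div (hP.add_const 1) hne) (fun w hw => ?_) (by simp [h0]) hz1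
    rw [mem_closedBall_zero_iff, norm_div, div_le_one (norm_pos_iff.2 (hne w hw)),
      ← sq_le_sq₀ (norm_nonneg _) (norm_nonneg _), ← Complex.normSq_eq_norm_sq,
      ← Complex.normSq_eq_norm_sq, Complex.normSq_apply, Complex.normSq_apply]
    simp
    nlinarith [hre w hw]
  rw [norm_div, div_le_iff₀ (norm_pos_iff.2 (hne z hz)),
    ← sq_le_sq₀ (norm_nonneg _) (by positivity), mul_pow, ← Complex.normSq_eq_norm_sq (P z - 1),
    ← Complex.normSq_eq_norm_sq (P z + 1), Complex.normSq_apply, Complex.normSq_apply] at hQ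
  simp only [Complex.sub_re, Complex.one_re, Complex.sub_im, Complex.one_im, sub_zero,
    Complex.add_re, Complex.add_im, add_zero] at hQ
  rw [div_le_iff₀ (by positivity)]
  set r := ‖z‖
  have hr : 0 ≤ r := norm_nonneg z
  by_contra! hc
  have hx := hre z hz
  set x := (P z).re
  set y := (P z).im
  have h1 : (x - 1) ^ 2 ≤ (r * (x + 1)) ^ 2 := by
    nlinarith [mul_nonneg (mul_self_nonneg y) (by nlinarith : 0 ≤ 1 - r ^ 2)]
  have := abs_le_of_sq_le_sq' h1 (by positivity)
  nlinarith [this.1]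

theorem harnack_lower_bound_of_le_re {P : ℂ → ℂ} {t : ℝ}
    (hP : DifferentiableOn ℂ P (Metric.ball 0 1)) (h0 : P 0 = 1)
    (hre : ∀ z ∈ Metric.ball (0 : ℂ) 1, t ≤ (P z).re) {z : ℂ} (hz : z ∈ Metric.ball (0 : ℂ) 1) :
    t + (1 - t) * ((1 - ‖z‖) / (1 + ‖z‖)) ≤ (P z).re := by
  have ht : t ≤ 1 := by simpa [h0] using hre 0 (by simp)
  rcases ht.eq_or_lt with rfl | ht
  · simpa using hre z hz
  have h1t : (((1 - t : ℝ)) : ℂ) ≠ 0 := by exact_mod_cast (sub_pos.2 ht).ne'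
  have key : ∀ w, ((P w - t) / ((1 - t : ℝ) : ℂ)).re = ((P w).re - t) / (1 - t) := fun w => by
    rw [Complex.div_ofReal_re]; simp
  have := harnack_lower_bound (P := fun w => (P w - t) / ((1 - t : ℝ) : ℂ))
    ((hP.sub_const _).div_const _) (by rw [h0]; push_cast at h1t ⊢; exact div_self h1t)
    (fun w hw => by
      rw [key]; exact div_nonneg (sub_nonneg.2 (hre w hw)) (sub_nonneg.2 ht.le)) hz
  rw [key, le_div_iff₀ (sub_pos.2 ht)] at this
  linarith

/-! ### The substitution `f = z g` and radial derivatives -/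

theorem deriv_id_mul {g : ℂ → ℂ} (hg : DifferentiableOn ℂ g (Metric.ball 0 1)) {z : ℂ}
    (hz : z ∈ Metric.ball (0 : ℂ) 1) : deriv (fun w => w * g w) z = g z + z * deriv g z := by
  have hgz := (hg.differentiableAt (Metric.isOpen_ball.mem_nhds hz)).hasDerivAt
  simpa using ((hasDerivAt_id' z).fun_mul hgz).deriv

theorem id_mul_mem_classA_iff {g : ℂ → ℂ} (hg : DifferentiableOn ℂ g (Metric.ball 0 1))
    (h0 : g 0 = 1) (s t : ℝ) : (fun z => z * g z) ∈ classA s t ↔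
      ∀ z ∈ Metric.ball (0 : ℂ) 1, z ≠ 0 → s * t ≤ s * (g z).re + (z * deriv g z).re := by
  have hN : (fun z => z * g z) ∈ normalizedHolomorphic := by
    refine ⟨differentiableOn_id.mul hg, by simp, ?_⟩
    rw [deriv_id_mul hg (by simp)]; simp [h0]
  have key : ∀ z ∈ Metric.ball (0 : ℂ) 1, z ≠ 0 →
      (((s : ℂ) - 1) * (z * g z / z) + deriv (fun w => w * g w) z).re =
        s * (g z).re + (z * deriv g z).re := fun z hz hz0 => by
    rw [deriv_id_mul hg hz, mul_div_cancel_left₀ _ hz0,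
      show ((s : ℂ) - 1) * g z + (g z + z * deriv g z) = s * g z + z * deriv g z by ring,
      Complex.add_re, Complex.re_ofReal_mul]
  exact ⟨fun h z hz hz0 => (h.2 z hz hz0).trans_eq (key z hz hz0),
    fun h => ⟨hN, fun z hz hz0 => (h z hz hz0).trans_eq (key z hz hz0).symm⟩⟩

theorem exists_eq_id_mul {f : ℂ → ℂ} (hf : f ∈ normalizedHolomorphic) :
    ∃ g : ℂ → ℂ, DifferentiableOn ℂ g (Metric.ball 0 1) ∧ g 0 = 1 ∧ f = fun z => z * g z := by
  obtain ⟨hd, h0, h1⟩ := hf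
  refine ⟨dslope f 0, (Complex.differentiableOn_dslope (Metric.ball_mem_nhds 0 one_pos)).2 hd,
    by simpa using h1, funext fun z => ?_⟩
  simpa [h0] using (sub_smul_dslope f 0 z).symm

theorem hasDerivAt_re_comp_ofReal_mul {g : ℂ → ℂ} (hg : DifferentiableOn ℂ g (Metric.ball 0 1))
    {z : ℂ} {x : ℝ} (hx : (x : ℂ) * z ∈ Metric.ball (0 : ℂ) 1) :
    HasDerivAt (fun u : ℝ => (g (u * z)).re) (z * deriv g (x * z)).re x := by
  have h1 := (hg.differentiableAt (Metric.isOpen_ball.mem_nhds hx)).hasDerivAt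
  have h2 : HasDerivAt (fun w : ℂ => g (w * z)) (deriv g (x * z) * (1 * z)) (x : ℂ) :=
    HasDerivAt.comp (x : ℂ) h1 ((hasDerivAt_id (x : ℂ)).mul_const z)
  have := h2.real_of_complex
  rwa [one_mul, mul_comm] at this

theorem ofReal_mul_mem_ball {z : ℂ} (hz : z ∈ Metric.ball (0 : ℂ) 1) {x : ℝ}
    (hx : x ∈ Icc (0 : ℝ) 1) : (x : ℂ) * z ∈ Metric.ball (0 : ℂ) 1 := by
  rw [mem_ball_zero_iff] at hz ⊢
  rw [norm_mul, Complex.norm_of_nonneg hx.1]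
  exact (mul_le_of_le_one_left (norm_nonneg z) hx.2).trans_lt hz

theorem continuousOn_re_comp_ofReal_mul {g : ℂ → ℂ}
    (hg : DifferentiableOn ℂ g (Metric.ball 0 1)) {z : ℂ} (hz : z ∈ Metric.ball (0 : ℂ) 1) :
    ContinuousOn (fun u : ℝ => (g (u * z)).re) (Icc 0 1) := fun _ hx =>
  (hasDerivAt_re_comp_ofReal_mul hg (ofReal_mul_mem_ball hz hx)).continuousAt.continuousWithinAt

/-! ### The lower bound for `Re g` -/

theorem intervalIntegrable_mul_rpow_sub_one {s : ℝ} (hs : 0 < s) :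
    IntervalIntegrable (fun x : ℝ => s * x ^ (s - 1)) volume 0 1 :=
  (intervalIntegral.intervalIntegrable_rpow' (by linarith)).const_mul s

theorem integral_mul_rpow_sub_one {s : ℝ} (hs : 0 < s) :
    ∫ x in (0 : ℝ)..1, s * x ^ (s - 1) = 1 := by
  rw [intervalIntegral.integral_const_mul, integral_rpow (Or.inl (by linarith))]
  simp [hs.ne']

theorem intervalIntegrable_xi0 {s : ℝ} (hs : 0 < s) :
    IntervalIntegrable (fun x : ℝ => (1 - x) / (1 + x) * (s * x ^ (s - 1))) volume 0 1 := by
  refine (intervalIntegrable_mul_rpow_sub_one hs).continuousOn_mul ?_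
  rw [uIcc_of_le zero_le_one]
  exact ContinuousOn.div (by fun_prop) (by fun_prop) fun x hx => by linarith [hx.1]

theorem xi0_le_one {s : ℝ} (hs : 0 < s) : xi0 s ≤ 1 := by
  rw [← integral_mul_rpow_sub_one hs]
  refine intervalIntegral.integral_mono_on zero_le_one (intervalIntegrable_xi0 hs)
    (intervalIntegrable_mul_rpow_sub_one hs) fun x hx => ?_
  have : 0 ≤ s * x ^ (s - 1) := mul_nonneg hs.le (Real.rpow_nonneg hx.1 _)
  exact mul_le_of_le_one_left this (by rw [div_le_one (by linarith [hx.1])]; linarith [hx.1])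

/-- The sharp lower bound of `Re (f z / z)` on `classA s t`. -/
theorem le_re_of_id_mul_mem_classA {g : ℂ → ℂ} (hg : DifferentiableOn ℂ g (Metric.ball 0 1))
    (h0 : g 0 = 1) {s t : ℝ} (hs : 0 < s) (ht : t ≤ 1)
    (hf : (fun z => z * g z) ∈ classA s t) {z : ℂ} (hz : z ∈ Metric.ball (0 : ℂ) 1) :
    t + (1 - t) * xi0 s ≤ (g z).re := by
  rw [id_mul_mem_classA_iff hg h0] at hf
  have hP : ∀ w ∈ Metric.ball (0 : ℂ) 1,
      t + (1 - t) * ((1 - ‖w‖) / (1 + ‖w‖)) ≤ (g w).re + (w * deriv g w).re / s := by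
    intro w hw
    have hre : ∀ w, (g w + w * deriv g w / (s : ℂ)).re = (g w).re + (w * deriv g w).re / s :=
      fun w => by rw [Complex.add_re, Complex.div_ofReal_re]
    have := harnack_lower_bound_of_le_re (P := fun w => g w + w * deriv g w / (s : ℂ)) (t := t)
      (hg.add ((differentiableOn_id.mul (hg.deriv Metric.isOpen_ball)).div_const _))
      (by simp [h0]) (fun v hv => ?_) hw
    · rwa [hre] at this
    · rw [hre]
      by_cases hv0 : v = 0
      · simpa [hv0, h0] using ht
      · have := hf v hv hv0
        rw [← mul_le_mul_iff_of_pos_left hs, mul_add, mul_div_cancel₀ _ hs.ne']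
        exact this
  have hint : IntervalIntegrable
      (fun x : ℝ => t * (s * x ^ (s - 1)) +
        (1 - t) * ((1 - x) / (1 + x) * (s * x ^ (s - 1)))) volume 0 1 :=
    ((intervalIntegrable_mul_rpow_sub_one hs).const_mul t).add
      ((intervalIntegrable_xi0 hs).const_mul (1 - t))
  have hz1 : ‖z‖ < 1 := by simpa using hz
  -- `s x ^ (s - 1) (g + z g' / s)` evaluated at `x z` is the derivative of `x ^ s g(x z)`. Only
  -- interior derivatives are needed, as `x ^ s` may fail to be differentiable at `0`.
  have hmain := intervalIntegral.integral_le_sub_of_hasDeriv_right_of_le (a := 0) (b := 1)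
    (g := fun x : ℝ => x ^ s * (g (x * z)).re)
    (g' := fun x : ℝ => s * x ^ (s - 1) * (g (x * z)).re + x ^ s * (z * deriv g (x * z)).re)
    (φ := fun x : ℝ => t * (s * x ^ (s - 1)) + (1 - t) * ((1 - x) / (1 + x) * (s * x ^ (s - 1))))
    zero_le_one
    ((Real.continuous_rpow_const hs.le).continuousOn.mul (continuousOn_re_comp_ofReal_mul hg hz))
    (fun x hx => ((Real.hasDerivAt_rpow_const (Or.inl hx.1.ne')).mul
      (hasDerivAt_re_comp_ofReal_mul hg
        (ofReal_mul_mem_ball hz (Ioo_subset_Icc_self hx)))).hasDerivWithinAt)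
    ((intervalIntegrable_iff_integrableOn_Icc_of_le zero_le_one).1 hint)
    (fun x hx => ?_)
  · rw [intervalIntegral.integral_add ((intervalIntegrable_mul_rpow_sub_one hs).const_mul t)
      ((intervalIntegrable_xi0 hs).const_mul (1 - t)), intervalIntegral.integral_const_mul t,
      intervalIntegral.integral_const_mul (1 - t), integral_mul_rpow_sub_one hs] at hmain
    simpa [hs.ne', xi0] using hmain
  · have h1 := hP _ (ofReal_mul_mem_ball hz (Ioo_subset_Icc_self hx))
    have hxs : x ^ s = x ^ (s - 1) * x := by
      rw [← Real.rpow_add_one hx.1.ne']; simp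
    have hn : ‖(x : ℂ) * z‖ ≤ x := by
      rw [norm_mul, Complex.norm_of_nonneg hx.1.le]
      exact mul_le_of_le_one_right hx.1.le hz1.le
    have h2 : (1 - x) / (1 + x) ≤ (1 - ‖(x : ℂ) * z‖) / (1 + ‖(x : ℂ) * z‖) := by
      have := norm_nonneg ((x : ℂ) * z)
      rw [div_le_div_iff₀ (by linarith [hx.1]) (by linarith)]
      nlinarith
    have h3 : ((x : ℂ) * z * deriv g (x * z)).re = x * (z * deriv g (x * z)).re := by
      rw [mul_assoc, Complex.re_ofReal_mul]
    rw [h3] at h1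
    have h4 := mul_le_mul_of_nonneg_left h2 (sub_nonneg.2 ht)
    have h5 : 0 ≤ s * x ^ (s - 1) := mul_nonneg hs.le (Real.rpow_nonneg hx.1.le _)
    have h6 := mul_le_mul_of_nonneg_left ((add_le_add_right h4 t).trans h1) h5
    calc _ = s * x ^ (s - 1) * (t + (1 - t) * ((1 - x) / (1 + x))) := by ring
      _ ≤ _ := h6
      _ = _ := by rw [hxs]; field_simp

/-! ### Inclusions between classes -/

/-- At index `0` the condition is `Re (z g') ≥ 0`, so `Re g` increases along radii from `g 0 = 1`,
and `s Re g ≥ s ≥ s t'`. -/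
theorem classA_zero_subset {s : ℝ} (hs : 0 ≤ s) {t t' : ℝ} (ht' : t' ≤ 1) :
    classA 0 t ⊆ classA s t' := by
  intro f hf
  obtain ⟨g, hg, h0, rfl⟩ := exists_eq_id_mul hf.1
  rw [id_mul_mem_classA_iff hg h0] at hf ⊢
  intro z hz hz0
  have hmono : MonotoneOn (fun x : ℝ => (g (x * z)).re) (Icc 0 1) := by
    refine monotoneOn_of_deriv_nonneg (convex_Icc 0 1) (continuousOn_re_comp_ofReal_mul hg hz)
      (fun x hx => ?_) fun x hx => ?_ <;> rw [interior_Icc] at hx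
    · exact (hasDerivAt_re_comp_ofReal_mul hg (ofReal_mul_mem_ball hz
        (Ioo_subset_Icc_self hx))).differentiableAt.differentiableWithinAt
    · have hb := ofReal_mul_mem_ball hz (Ioo_subset_Icc_self hx)
      rw [(hasDerivAt_re_comp_ofReal_mul hg hb).deriv]
      have := hf _ hb (mul_ne_zero (by exact_mod_cast hx.1.ne') hz0)
      rw [mul_assoc, Complex.re_ofReal_mul] at this
      simp only [zero_mul, zero_add] at this
      exact nonneg_of_mul_nonneg_right this hx.1
  have h1 : 1 ≤ (g z).re := by
    simpa [h0] using hmono (left_mem_Icc.2 zero_le_one) (right_mem_Icc.2 zero_le_one) zero_le_one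
  have h2 := hf z hz hz0
  simp only [zero_mul, zero_add] at h2
  nlinarith

theorem classA_subset_classA {a b t t' : ℝ} (ha : 0 < a) (hab : a < b) (ht : t ≤ 1)
    (h : t' ≤ t + (1 - t) * ((1 - a / b) * xi0 a)) : classA a t ⊆ classA b t' := by
  intro f hf
  obtain ⟨g, hg, h0, rfl⟩ := exists_eq_id_mul hf.1
  rw [id_mul_mem_classA_iff hg h0]
  intro z hz hz0
  have h1 := le_re_of_id_mul_mem_classA hg h0 ha ht hf hz
  have h2 := (id_mul_mem_classA_iff hg h0 _ _).1 hf z hz hz0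
  have hb : 0 < b := ha.trans hab
  calc b * t' ≤ b * (t + (1 - t) * ((1 - a / b) * xi0 a)) := by gcongr
    _ = (b - a) * (t + (1 - t) * xi0 a) + a * t := by field_simp; ring
    _ ≤ (b - a) * (g z).re + a * t := by gcongr
    _ ≤ _ := by linarith

/-! ### The extremal function and sharpness -/

/-- The solution `G` of `a G + z G' = a (1 - z) / (1 + z)` that is extremal for
`le_re_of_id_mul_mem_classA`. -/
noncomputable def extremalFun (a : ℝ) (z : ℂ) : ℂ :=
  ∫ x in (0 : ℝ)..1, ((a * x ^ (a - 1) : ℝ) : ℂ) * ((1 - x * z) / (1 + x * z))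

theorem one_add_ne_zero_of_mem_ball {w : ℂ} (hw : w ∈ Metric.ball (0 : ℂ) 1) : 1 + w ≠ 0 := by
  intro h
  rw [mem_ball_zero_iff, eq_neg_of_add_eq_zero_right h] at hw
  simp at hw

theorem hasDerivAt_one_sub_div_one_add {w : ℂ} (hw : 1 + w ≠ 0) :
    HasDerivAt (fun w : ℂ => (1 - w) / (1 + w)) (-2 / (1 + w) ^ 2) w := by
  refine (((hasDerivAt_id' w).const_sub 1).fun_div ((hasDerivAt_id' w).const_add 1) hw).congr_deriv ?_
  ring

theorem continuousOn_ofReal_mul {z : ℂ} (hz : z ∈ Metric.ball (0 : ℂ) 1) {h : ℂ → ℂ}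
    (hh : ContinuousOn h (Metric.ball 0 1)) :
    ContinuousOn (fun x : ℝ => h (x * z)) (Icc 0 1) :=
  hh.comp (by fun_prop) fun _ hx => ofReal_mul_mem_ball hz hx

theorem intervalIntegrable_rpow_mul {a : ℝ} (ha : 0 < a) {h : ℝ → ℂ}
    (hh : ContinuousOn h (Icc 0 1)) :
    IntervalIntegrable (fun x : ℝ => ((a * x ^ (a - 1) : ℝ) : ℂ) * h x) volume 0 1 :=
  IntervalIntegrable.mul_continuousOn
    (intervalIntegrable_iff.2 (intervalIntegrable_mul_rpow_sub_one ha).def'.ofReal)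
    (by rwa [uIcc_of_le zero_le_one])

theorem continuousOn_one_sub_div_one_add :
    ContinuousOn (fun w : ℂ => (1 - w) / (1 + w)) (Metric.ball 0 1) := fun _ hw =>
  (hasDerivAt_one_sub_div_one_add
    (one_add_ne_zero_of_mem_ball hw)).continuousAt.continuousWithinAt

theorem continuousOn_deriv_one_sub_div_one_add :
    ContinuousOn (fun w : ℂ => -2 / (1 + w) ^ 2) (Metric.ball 0 1) :=
  ContinuousOn.div (by fun_prop) (by fun_prop)
    fun _ hw => pow_ne_zero 2 (one_add_ne_zero_of_mem_ball hw)

theorem hasDerivAt_extremalFun {a : ℝ} (ha : 0 < a) {z : ℂ} (hz : z ∈ Metric.ball (0 : ℂ) 1) :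
    HasDerivAt (extremalFun a)
      (∫ x in (0 : ℝ)..1, ((a * x ^ (a - 1) : ℝ) : ℂ) * (x * (-2 / (1 + x * z) ^ 2))) z := by
  have hz1 : ‖z‖ < 1 := by simpa using hz
  -- A radius strictly between `‖z‖` and `1` bounds `|1 + x w|` below by `1 - r`, uniformly for `w`
  -- near `z`.
  obtain ⟨r, hzr, hr1⟩ := exists_between hz1
  have hr0 : 0 ≤ r := (norm_nonneg z).trans hzr.le
  have hball : ∀ w ∈ Metric.ball (0 : ℂ) r, w ∈ Metric.ball (0 : ℂ) 1 :=
    fun w hw => Metric.ball_subset_ball hr1.le hw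
  have hmem : Metric.ball (0 : ℂ) r ∈ nhds z := Metric.isOpen_ball.mem_nhds (by simpa using hzr)
  have hF : ∀ w ∈ Metric.ball (0 : ℂ) 1, IntervalIntegrable
      (fun x : ℝ => ((a * x ^ (a - 1) : ℝ) : ℂ) * ((1 - x * w) / (1 + x * w))) volume 0 1 :=
    fun w hw => intervalIntegrable_rpow_mul ha
      (continuousOn_ofReal_mul hw continuousOn_one_sub_div_one_add)
  have hF' : IntervalIntegrable
      (fun x : ℝ => ((a * x ^ (a - 1) : ℝ) : ℂ) * (x * (-2 / (1 + x * z) ^ 2))) volume 0 1 :=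
    intervalIntegrable_rpow_mul ha (Complex.continuous_ofReal.continuousOn.mul
      (continuousOn_ofReal_mul hz continuousOn_deriv_one_sub_div_one_add))
  refine (intervalIntegral.hasDerivAt_integral_of_dominated_loc_of_deriv_le
    (F := fun (w : ℂ) (x : ℝ) =>
      ((a * x ^ (a - 1) : ℝ) : ℂ) * ((1 - x * w) / (1 + x * w)))
    (F' := fun (w : ℂ) (x : ℝ) => ((a * x ^ (a - 1) : ℝ) : ℂ) * (x * (-2 / (1 + x * w) ^ 2)))
    (bound := fun x => a * x ^ (a - 1) * (2 / (1 - r) ^ 2)) hmem ?_ (hF z hz)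
    hF'.def'.aestronglyMeasurable ?_ ((intervalIntegrable_mul_rpow_sub_one ha).mul_const _) ?_).2
  · filter_upwards [hmem] with w hw using
      (hF w (hball w hw)).def'.aestronglyMeasurable
  · refine Filter.Eventually.of_forall fun x hx w hw => ?_
    rw [uIoc_of_le zero_le_one] at hx
    have hx0 : 0 ≤ a * x ^ (a - 1) := mul_nonneg ha.le (Real.rpow_nonneg hx.1.le _)
    have hw' : ‖w‖ < r := by simpa using hw
    have hxw : ‖(x : ℂ) * w‖ ≤ r := by
      rw [norm_mul, Complex.norm_of_nonneg hx.1.le]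
      exact (mul_le_of_le_one_left (norm_nonneg w) hx.2).trans hw'.le
    have h1 : 1 - r ≤ ‖1 + (x : ℂ) * w‖ := by
      have := norm_sub_le_norm_add (1 : ℂ) (x * w)
      rw [norm_one] at this
      linarith
    rw [norm_mul, Complex.norm_of_nonneg hx0, norm_mul, Complex.norm_of_nonneg hx.1.le, norm_div,
      norm_pow, norm_neg, Complex.norm_ofNat]
    gcongr
    refine (mul_le_of_le_one_left (by positivity) hx.2).trans ?_
    have : 0 < 1 - r := by linarith
    gcongr
  · refine Filter.Eventually.of_forall fun x hx w hw => ?_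
    rw [uIoc_of_le zero_le_one] at hx
    have hb := ofReal_mul_mem_ball (hball w hw) (Ioc_subset_Icc_self hx)
    have h1 := HasDerivAt.comp w (hasDerivAt_one_sub_div_one_add (one_add_ne_zero_of_mem_ball hb))
      ((hasDerivAt_id' w).const_mul (x : ℂ))
    have := h1.const_mul ((a * x ^ (a - 1) : ℝ) : ℂ)
    rwa [mul_one, mul_comm (-2 / _) (x : ℂ)] at this

/-- The left side is the integral over `[0, 1]` of the derivative in `x` of `a x ^ a (1 - x z) / (1
+ x z)`; the endpoint `0` contributes nothing because `a > 0`. -/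
theorem extremalFun_ode {a : ℝ} (ha : 0 < a) {z : ℂ} (hz : z ∈ Metric.ball (0 : ℂ) 1) :
    a * extremalFun a z + z * deriv (extremalFun a) z = a * ((1 - z) / (1 + z)) := by
  have hF : IntervalIntegrable
      (fun x : ℝ => ((a * x ^ (a - 1) : ℝ) : ℂ) * ((1 - x * z) / (1 + x * z))) volume 0 1 :=
    intervalIntegrable_rpow_mul ha (continuousOn_ofReal_mul hz continuousOn_one_sub_div_one_add)
  have hF' : IntervalIntegrable
      (fun x : ℝ => ((a * x ^ (a - 1) : ℝ) : ℂ) * (x * (-2 / (1 + x * z) ^ 2))) volume 0 1 :=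
    intervalIntegrable_rpow_mul ha (Complex.continuous_ofReal.continuousOn.mul
      (continuousOn_ofReal_mul hz continuousOn_deriv_one_sub_div_one_add))
  have hG : ∀ x ∈ Icc (0 : ℝ) 1, HasDerivAt (fun u : ℝ => (1 - u * z) / (1 + u * z))
      (-2 / (1 + x * z) ^ 2 * z) x := fun x hx => by
    have h1 := HasDerivAt.comp (x : ℂ)
      (hasDerivAt_one_sub_div_one_add (one_add_ne_zero_of_mem_ball (ofReal_mul_mem_ball hz hx)))
      ((hasDerivAt_id' (x : ℂ)).mul_const z)
    rw [one_mul] at h1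
    exact h1.comp_ofReal
  have key := intervalIntegral.integral_eq_sub_of_hasDerivAt_of_le (a := 0) (b := 1)
    (f := fun x : ℝ => a * (((x ^ a : ℝ) : ℂ) * ((1 - x * z) / (1 + x * z))))
    (f' := fun x : ℝ => a * (((a * x ^ (a - 1) : ℝ) : ℂ) * ((1 - x * z) / (1 + x * z))) +
      z * (((a * x ^ (a - 1) : ℝ) : ℂ) * (x * (-2 / (1 + x * z) ^ 2)))) zero_le_one
    (continuousOn_const.mul ((Complex.continuous_ofReal.comp
      (Real.continuous_rpow_const ha.le)).continuousOn.mul fun x hx =>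
        (hG x hx).continuousAt.continuousWithinAt))
    (fun x hx => by
      have h1 := (((Real.hasDerivAt_rpow_const (p := a) (Or.inl hx.1.ne')).ofReal_comp).fun_mul
        (hG x (Ioo_subset_Icc_self hx))).const_mul (a : ℂ)
      refine h1.congr_deriv ?_
      have hxs : x ^ a = x ^ (a - 1) * x := by
        rw [← Real.rpow_add_one hx.1.ne']; simp
      rw [hxs]
      push_cast
      ring)
    ((hF.const_mul _).add (hF'.const_mul _))
  rw [intervalIntegral.integral_add (hF.const_mul _) (hF'.const_mul _),
    intervalIntegral.integral_const_mul (a : ℂ), intervalIntegral.integral_const_mul z] at key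
  rw [(hasDerivAt_extremalFun ha hz).deriv, extremalFun, key]
  simp [Real.zero_rpow ha.ne']

theorem extremalFun_zero {a : ℝ} (ha : 0 < a) : extremalFun a 0 = 1 := by
  have h := extremalFun_ode ha (z := 0) (by simp)
  have : (a : ℂ) ≠ 0 := by exact_mod_cast ha.ne'
  simpa [this] using h

theorem differentiableOn_extremalFun {a : ℝ} (ha : 0 < a) :
    DifferentiableOn ℂ (extremalFun a) (Metric.ball 0 1) := fun _ hz =>
  (hasDerivAt_extremalFun ha hz).differentiableAt.differentiableWithinAt

/-- An explicit error term stands in for continuity of `extremalFun a` at the boundary point `1`. -/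
theorem re_extremalFun_le {a : ℝ} (ha : 0 < a) {r : ℝ} (hr0 : 0 ≤ r) (hr1 : r < 1) :
    (extremalFun a r).re ≤ xi0 a + 2 * (1 - r) := by
  have hcast : extremalFun a r =
      ((∫ x in (0 : ℝ)..1, a * x ^ (a - 1) * ((1 - x * r) / (1 + x * r)) : ℝ) : ℂ) := by
    rw [extremalFun, ← intervalIntegral.integral_ofReal]
    push_cast
    rfl
  have hI := intervalIntegrable_mul_rpow_sub_one ha
  have hxi : xi0 a + 2 * (1 - r) = xi0 a + ∫ x in (0 : ℝ)..1, 2 * (1 - r) * (a * x ^ (a - 1)) := by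
    rw [intervalIntegral.integral_const_mul (2 * (1 - r)), integral_mul_rpow_sub_one ha, mul_one]
  rw [hcast, Complex.ofReal_re, hxi, xi0,
    ← intervalIntegral.integral_add (intervalIntegrable_xi0 ha) (hI.const_mul _)]
  refine intervalIntegral.integral_mono_on zero_le_one (hI.mul_continuousOn ?_)
    ((intervalIntegrable_xi0 ha).add (hI.const_mul _)) fun x hx => ?_
  · rw [uIcc_of_le zero_le_one]
    exact ContinuousOn.div (by fun_prop) (by fun_prop)
      fun x hx => by nlinarith [mul_nonneg hx.1 hr0]
  · have h0 : 0 ≤ a * x ^ (a - 1) := mul_nonneg ha.le (Real.rpow_nonneg hx.1 _)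
    have hxr : 0 ≤ x * r := mul_nonneg hx.1 hr0
    have hx1 : 0 < 1 + x := by linarith [hx.1]
    have hxr1 : 0 < 1 + x * r := by linarith
    have hle : (1 - x * r) / (1 + x * r) ≤ (1 - x) / (1 + x) + 2 * (1 - r) := by
      have : (1 - x * r) / (1 + x * r) - (1 - x) / (1 + x) =
          2 * (x * (1 - r)) / ((1 + x * r) * (1 + x)) := by field_simp; ring
      have h2 : 2 * (x * (1 - r)) / ((1 + x * r) * (1 + x)) ≤ 2 * (1 - r) := by
        rw [div_le_iff₀ (by positivity)]
        have : 0 ≤ x * r * (1 + x) := by positivity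
        nlinarith [mul_nonneg (sub_nonneg.2 hr1.le) (by linarith : 0 ≤ 1 + x * r * (1 + x))]
      linarith
    calc _ ≤ a * x ^ (a - 1) * ((1 - x) / (1 + x) + 2 * (1 - r)) :=
          mul_le_mul_of_nonneg_left hle h0
      _ = _ := by ring

/-- Test on `g = t + (1 - t) G` with `G = extremalFun a`: as `z = r ↑ 1`, the bounds on `Re g` and
on `a Re g + Re (z g')` become equalities simultaneously. -/
theorem le_of_classA_subset_classA {a b t t' : ℝ} (ha : 0 < a) (hab : a < b) (ht : t ≤ 1)
    (h : classA a t ⊆ classA b t') : t' ≤ t + (1 - t) * ((1 - a / b) * xi0 a) := by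
  have hb : 0 < b := ha.trans hab
  set g : ℂ → ℂ := fun z => t + (1 - t) * extremalFun a z with hgdef
  have hg : DifferentiableOn ℂ g (Metric.ball 0 1) :=
    ((differentiableOn_extremalFun ha).const_mul _).const_add _
  have hg0 : g 0 = 1 := by simp [hgdef, extremalFun_zero ha]
  have hgre : ∀ z, (g z).re = t + (1 - t) * (extremalFun a z).re := fun z => by
    have : g z = ((t : ℝ) : ℂ) + ((1 - t : ℝ) : ℂ) * extremalFun a z := by simp [hgdef]
    rw [this, Complex.add_re, Complex.re_ofReal_mul, Complex.ofReal_re]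
  have hode : ∀ z ∈ Metric.ball (0 : ℂ) 1, a * (g z).re + (z * deriv g z).re =
      a * (t + (1 - t) * ((1 - z) / (1 + z)).re) := fun z hz => by
    have hd : deriv g z = (1 - t) * deriv (extremalFun a) z :=
      (((hasDerivAt_extremalFun ha hz).const_mul (1 - t : ℂ)).const_add (t : ℂ)).deriv.trans
        (by rw [(hasDerivAt_extremalFun ha hz).deriv])
    have h1 : (a : ℂ) * g z + z * deriv g z =
        ((a * t : ℝ) : ℂ) + ((a * (1 - t) : ℝ) : ℂ) * ((1 - z) / (1 + z)) := by
      have := extremalFun_ode ha hz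
      rw [hd]
      push_cast
      linear_combination (1 - (t : ℂ)) * this
    have h2 := congrArg Complex.re h1
    rw [Complex.add_re, Complex.re_ofReal_mul, Complex.add_re (((a * t : ℝ)) : ℂ),
      Complex.ofReal_re, Complex.re_ofReal_mul] at h2
    linarith
  have hmem : (fun z => z * g z) ∈ classA a t := by
    rw [id_mul_mem_classA_iff hg hg0]
    intro z hz _
    rw [hode z hz]
    have hz1 : ‖z‖ < 1 := by simpa using hz
    have : 0 ≤ ((1 - z) / (1 + z)).re := by
      rw [Complex.div_re, ← add_div]
      refine div_nonneg ?_ (Complex.normSq_nonneg _)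
      have : z.re * z.re + z.im * z.im < 1 := by
        rw [← Complex.normSq_apply, Complex.normSq_eq_norm_sq]
        nlinarith [norm_nonneg z]
      simp
      nlinarith
    nlinarith [mul_nonneg (sub_nonneg.2 ht) this, mul_nonneg ha.le (mul_nonneg (sub_nonneg.2 ht) this)]
  have hmem' := (id_mul_mem_classA_iff hg hg0 _ _).1 (h hmem)
  have hr : ∀ r ∈ Ioo (0 : ℝ) 1, b * t' ≤
      (b - a) * (t + (1 - t) * (xi0 a + 2 * (1 - r))) + a * (t + (1 - t) * (1 - r)) := by
    intro r hr
    have hrb : (r : ℂ) ∈ Metric.ball (0 : ℂ) 1 := by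
      rw [mem_ball_zero_iff, Complex.norm_of_nonneg hr.1.le]; exact hr.2
    have h1 := hmem' r hrb (by exact_mod_cast hr.1.ne')
    have h2 := hode r hrb
    have h3 : ((1 - (r : ℂ)) / (1 + r)).re = (1 - r) / (1 + r) := by
      rw [← Complex.ofReal_re ((1 - r) / (1 + r))]; push_cast; rfl
    rw [h3] at h2
    have h4 : (1 - r) / (1 + r) ≤ 1 - r := div_le_self (by linarith [hr.2]) (by linarith [hr.1])
    have ht' := sub_nonneg.2 ht
    have hba := sub_nonneg.2 hab.le
    calc b * t' ≤ (b - a) * (g r).re + (a * (g r).re + ((r : ℂ) * deriv g r).re) := by linarith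
      _ = (b - a) * (t + (1 - t) * (extremalFun a r).re) +
          a * (t + (1 - t) * ((1 - r) / (1 + r))) := by rw [h2, hgre]
      _ ≤ _ := by
        gcongr
        exact re_extremalFun_le ha hr.1.le hr.2
  have hlim : Filter.Tendsto (fun r : ℝ =>
      (b - a) * (t + (1 - t) * (xi0 a + 2 * (1 - r))) + a * (t + (1 - t) * (1 - r)))
      (nhdsWithin 1 (Iio 1)) (nhds ((b - a) * (t + (1 - t) * (xi0 a + 2 * (1 - 1))) +
        a * (t + (1 - t) * (1 - 1)))) :=
    (Continuous.tendsto (by fun_prop) 1).mono_left nhdsWithin_le_nhds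
  have hfin := ge_of_tendsto hlim
    (Filter.mem_of_superset (Ioo_mem_nhdsLT (zero_lt_one' ℝ)) fun r h => hr r h)
  rw [← mul_le_mul_iff_of_pos_left hb]
  calc b * t' ≤ _ := hfin
    _ = _ := by field_simp; ring

/-- The sharp inclusion criterion for two classes with positive indices. -/
theorem classA_subset_classA_iff {a b t t' : ℝ} (ha : 0 < a) (hab : a < b) (ht : t ≤ 1) :
    classA a t ⊆ classA b t' ↔ t' ≤ t + (1 - t) * ((1 - a / b) * xi0 a) :=
  ⟨le_of_classA_subset_classA ha hab ht, classA_subset_classA ha hab ht⟩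

/-! ### From the criterion to the differential inequality and back -/

theorem one_sub_mul_xi0_pos {a b : ℝ} (ha : 0 < a) (hab : a ≤ b) :
    0 < 1 - (1 - a / b) * xi0 a := by
  have h1 : 0 < a / b := div_pos ha (ha.trans_le hab)
  have h2 : a / b ≤ 1 := (div_le_one (ha.trans_le hab)).2 hab
  nlinarith [xi0_le_one ha]

/-- Transitivity of inclusion among the classes, read off from the sharp criterion. -/
theorem xi0_mul_le {a b : ℝ} (ha : 0 < a) (hab : a < b) :
    (1 - (1 - a / b) * xi0 a) * (xi0 b / b) ≤ a / b ^ 2 * xi0 a := by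
  have hb : 0 < b := ha.trans hab
  have h1 := classA_subset_classA ha hab zero_le_one (le_refl (0 + (1 - 0) * ((1 - a / b) * xi0 a)))
  set t := 0 + (1 - 0) * ((1 - a / b) * xi0 a) with ht
  have ht1 : t ≤ 1 := by have := one_sub_mul_xi0_pos ha hab.le; rw [ht]; linarith
  -- The third index `2 * b` is a convenient choice above `b`.
  have h2 := classA_subset_classA hb (lt_two_mul_self hb) ht1 le_rfl
  have h3 := le_of_classA_subset_classA ha (hab.trans (lt_two_mul_self hb)) zero_le_one
    (h1.trans h2)
  have e1 : 1 - b / (2 * b) = 1 / 2 := by field_simp; norm_num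
  rw [e1, ht] at h3
  have e2 : a / (2 * b) = a / b / 2 := by field_simp
  rw [e2] at h3
  have h4 : (1 - (1 - a / b) * xi0 a) * xi0 b ≤ a / b * xi0 a := by linarith
  calc _ = (1 - (1 - a / b) * xi0 a) * xi0 b / b := by ring
    _ ≤ a / b * xi0 a / b := by gcongr
    _ = _ := by field_simp

theorem deriv_le_of_isFiltrationOn {c : ℝ} (hc : 0 ≤ c) {T : ℝ → ℝ}
    (hT : ∀ s ∈ Ioi c, T s ≤ 1) (hd : DifferentiableOn ℝ T (Ioi c))
    (h : IsFiltrationOn (Ioi c) fun s => classA s (T s)) {s : ℝ} (hs : c < s) :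
    deriv T s ≤ (1 - T s) * (xi0 s / s) := by
  have hs0 : 0 < s := hc.trans_lt hs
  have h1 := (hd.differentiableAt (Ioi_mem_nhds hs)).hasDerivAt.hasDerivWithinAt (s := Ioi s)
  rw [hasDerivWithinAt_iff_tendsto_slope' (by simp)] at h1
  have h2 : Filter.Tendsto (fun u : ℝ => (1 - T s) * (xi0 s / u)) (nhdsWithin s (Ioi s))
      (nhds ((1 - T s) * (xi0 s / s))) :=
    ((continuousAt_const.div continuousAt_id hs0.ne').tendsto.const_mul _).mono_left
      nhdsWithin_le_nhds
  refine le_of_tendsto_of_tendsto h1 h2 ?_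
  filter_upwards [self_mem_nhdsWithin] with u hu
  have hu : s < u := hu
  have h3 := le_of_classA_subset_classA hs0 hu (hT s hs) (h s hs u (hs.trans hu) hu)
  rw [slope_def_field, div_le_iff₀ (sub_pos.2 hu)]
  have hu0 : 0 < u := hs0.trans hu
  calc T u - T s ≤ (1 - T s) * ((1 - s / u) * xi0 s) := by linarith
    _ = _ := by field_simp

/-- The denominator `1 - (1 - a / s) ξ₀(a)` is `1` minus the best parameter reachable at `s` from
`(a, 0)`. It equals `1` at `s = a`, so monotonicity of the quotient on `[a, b]` is enough. -/
theorem le_of_deriv_le {T : ℝ → ℝ} {a b : ℝ} (ha : 0 < a) (hab : a < b)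
    (hT : ∀ s ∈ Ioo a b, T s ≤ 1) (hcont : ContinuousOn T (Icc a b))
    (hd : DifferentiableOn ℝ T (Ioo a b))
    (h : ∀ s ∈ Ioo a b, deriv T s ≤ (1 - T s) * (xi0 s / s)) :
    T b ≤ T a + (1 - T a) * ((1 - a / b) * xi0 a) := by
  have hpos : ∀ s ∈ Icc a b, 0 < s := fun s hs => ha.trans_le hs.1
  have hder : ∀ s ∈ Ioo a b, HasDerivAt (fun s => (1 - T s) / (1 - (1 - a / s) * xi0 a))
      ((-deriv T s * (1 - (1 - a / s) * xi0 a) - (1 - T s) * (-(a / s ^ 2 * xi0 a))) /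
        (1 - (1 - a / s) * xi0 a) ^ 2) s := fun s hs => by
    have hs0 := hpos s (Ioo_subset_Icc_self hs)
    have h1 := (hd.differentiableAt (isOpen_Ioo.mem_nhds hs)).hasDerivAt
    have h2 : HasDerivAt (fun s => a / s) (-(a / s ^ 2)) s := by
      simpa [div_eq_mul_inv] using (hasDerivAt_inv hs0.ne').const_mul a
    have h3 := ((h2.const_sub 1).mul_const (xi0 a)).const_sub 1
    rw [neg_neg] at h3
    exact (h1.const_sub 1).fun_div h3 (one_sub_mul_xi0_pos ha hs.1.le).ne'
  have hmono : MonotoneOn (fun s => (1 - T s) / (1 - (1 - a / s) * xi0 a)) (Icc a b) := by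
    refine monotoneOn_of_deriv_nonneg (convex_Icc a b) ?_ (fun s hs => ?_) fun s hs => ?_
    · refine (continuousOn_const.sub hcont).div ?_
        fun s hs => (one_sub_mul_xi0_pos ha hs.1).ne'
      exact continuousOn_const.sub ((continuousOn_const.sub
        (continuousOn_const.div continuousOn_id fun s hs => (hpos s hs).ne')).mul
          continuousOn_const)
    · rw [interior_Icc] at hs
      exact (hder s hs).differentiableAt.differentiableWithinAt
    · rw [interior_Icc] at hs
      rw [(hder s hs).deriv]
      refine div_nonneg ?_ (sq_nonneg _)
      -- The hypothesis bounds `T'` by `ξ₀(s) / s`, and `xi0_mul_le` trades this for the derivative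
      -- of the denominator.
      have h1 := mul_le_mul_of_nonneg_right (h s hs) (one_sub_mul_xi0_pos ha hs.1.le).le
      have h2 := mul_le_mul_of_nonneg_left (xi0_mul_le ha hs.1) (sub_nonneg.2 (hT s hs))
      linarith
  have := hmono (left_mem_Icc.2 hab.le) (right_mem_Icc.2 hab.le) hab.le
  simp only [div_self ha.ne', sub_self, zero_mul, sub_zero, div_one] at this
  rw [le_div_iff₀ (one_sub_mul_xi0_pos ha hab.le)] at this
  linarith

theorem theorem4p2 (sStar : ℝ) (hs : 0 ≤ sStar) (T : ℝ → ℝ)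
    (hT : ∀ s ∈ Set.Ici sStar, T s ∈ Set.Ico (0 : ℝ) 1)
    (hdiff : DifferentiableOn ℝ T (Set.Ioi sStar)) :
    (IsFiltrationOn (Set.Ioi sStar) (fun s => classA s (T s)) ↔
        ∀ s : ℝ, sStar < s → deriv T s ≤ (1 - T s) * (xi0 s / s)) ∧
      (ContinuousWithinAt T (Set.Ici sStar) sStar →
        (IsFiltrationOn (Set.Ici sStar) (fun s => classA s (T s)) ↔
          ∀ s : ℝ, sStar < s → deriv T s ≤ (1 - T s) * (xi0 s / s))) := by
  have hT1 : ∀ s, sStar ≤ s → T s ≤ 1 := fun s h => (hT s h).2.le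
  have necessary (h : IsFiltrationOn (Ioi sStar) fun s => classA s (T s)) (s : ℝ)
      (hs' : sStar < s) : deriv T s ≤ (1 - T s) * (xi0 s / s) :=
    deriv_le_of_isFiltrationOn hs (fun u hu => hT1 u (le_of_lt hu)) hdiff h hs'
  have sufficient (h : ∀ s : ℝ, sStar < s → deriv T s ≤ (1 - T s) * (xi0 s / s)) (a b : ℝ)
      (ha0 : 0 < a) (ha : sStar ≤ a) (hab : a < b) (hc : ContinuousOn T (Icc a b)) :
      classA a (T a) ⊆ classA b (T b) :=
    classA_subset_classA ha0 hab (hT1 a ha) <|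
      le_of_deriv_le ha0 hab (fun s hs' => hT1 s (ha.trans hs'.1.le)) hc
        (hdiff.mono fun s hs' => ha.trans_lt hs'.1) fun s hs' => h s (ha.trans_lt hs'.1)
  refine ⟨⟨necessary, fun h a ha b _ hab => sufficient h a b (hs.trans_lt ha) (le_of_lt ha) hab
    (hdiff.continuousOn.mono fun s hs' => lt_of_lt_of_le ha hs'.1)⟩, fun hcont =>
    ⟨fun h => necessary fun a ha b hb =>
      h a (Ioi_subset_Ici_self ha) b (Ioi_subset_Ici_self hb),
      fun h a ha b hb hab => ?_⟩⟩
  have ha : sStar ≤ a := ha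
  -- Index `0` lies outside the criterion, but its class is contained in all later ones.
  rcases (hs.trans ha).eq_or_lt with rfl | ha0
  · exact classA_zero_subset hab.le (hT1 b hb)
  · refine sufficient h a b ha0 ha hab fun s hs' => ?_
    -- Right continuity is needed only at the endpoint `sStar`.
    rcases (ha.trans hs'.1).eq_or_lt with rfl | hlt
    · exact hcont.mono fun u hu => ha.trans hu.1
    · exact (hdiff.differentiableAt (Ioi_mem_nhds hlt)).continuousAt.continuousWithinAt
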